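/- Let $\Omega$ be a paracompact locally compact Hausdorff space, and let $\mathcal U=\{\Omega,(A_t)_{t\in\Omega},\Theta\}$ be a continuous field of (complex) $C^*$-algebras in the sense of Dixmier: $\Theta$ is an involutive subalgebra of $\prod_t A_t$ such that $\{x(t):x\in\Theta\}$ is dense in $A_t$ for every $t$, the function $t\mapsto\|x(t)\|$ is continuous for every $x\in\Theta$, and every vector field that can be approximated near each point, uniformly within every $\varepsilon>0$ on a neighbourhood, by elements of $\Theta$ belongs to $\Theta$. For $Y\subseteq\Omega$, $\mathcal U|_Y$ is the field over $Y$ whose continuous vector fields are those $x\in\prod_{t\in Y}A_t$ that can be so approximated near each point of $Y$ by elements of $\Theta$. A field is *trivial* if it is isomorphic, through $*$-isomorphisms of the fibres carrying one set of continuous vector fields onto the other, to a constant field (whose continuous vector fields are the continuous maps into a fixed $C^*$-algebra). Suppose that $\mathcal U$ is locally trivial (every point has an open neighbourhood $V$ such that $\mathcal U|_V$ is trivial), and that each $A_t$ contains a strictly positive element, that is, some $h\ge 0$ with $f(h)>0$ for every non-zero positive linear functional $f$ on $A_t$. Let $\ell\ge 1$ be an integer, and suppose that one of the following conditions holds: (i)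 $\dim\Omega\le\ell$, that is, every locally finite open cover of $\Omega$ has a locally finite open refinement that covers $\Omega$ and in which each point lies in at most $\ell+1$ members; (ii) $\mathcal U$ is $\ell$-locally trivial, that is, there are an open cover $\{U_\mu\}$ of $\Omega$ such that each $\mathcal U|_{U_\mu}$ is trivial, and an open cover $V_1,\dots,V_\ell$ of $\Omega$ such that each closure $\overline{V_j}$ is contained in some $U_\mu$. Let $\mathfrak A$ be the $C^*$-algebra of those $x\in\Theta$ for which $\|x(t)\|$ vanishes at infinity, with the supremum norm. Then $\mathfrak A$ is left projective: for every left Banach $\mathfrak A$-module $Y$, every morphism of left Banach $\mathfrak A$-modules $\varphi:Y\to\mathfrak A$ that has a bounded linear right inverse has a right inverse that is a morphism of left Banach $\mathfrak A$-modules. Moreover, there is a morphism of left Banach $\mathfrak A$-modules $\rho:\mathfrak A\to\mathfrak A\,\widehat\otimes\,\mathfrak A$ into the projective tensor product such that $\pi\circ\rho=\mathrm{id}_{\mathfrak A}$, where $\pi(a\otimes b)=ab$, and $\|\rho\|\le(4\ell)^2$. -/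

import Mathlib

open Filter Topology Set
open scoped ENNReal TensorProduct

universe u v w

noncomputable section

/-! ### Banach modules, projectivity, and the projective tensor square -/

section BanachModules

variable (A : Type v) [NonUnitalNormedRing A] [NormedSpace ℂ A] [IsScalarTower ℂ A A]
  [SMulCommClass ℂ A A]

/-- The structure of a left Banach `A`-module on a Banach space `Y`: a bounded bilinear map
`A × Y → Y`, `(a, y) ↦ a · y`, such that `(a b) · y = a · (b · y)`.  The algebra `A` need not have
an identity. -/
structure LeftBanachModule (Y : Type w) [NormedAddCommGroup Y] [NormedSpace ℂ Y] where
  /-- The action, as a bounded bilinear map. -/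
  act : A →L[ℂ] Y →L[ℂ] Y
  mul_act : ∀ (a b : A) (y : Y), act (a * b) y = act a (act b y)

/-- A Banach algebra `A` as a left Banach module over itself. -/
def LeftBanachModule.regular : LeftBanachModule A A where
  act := ContinuousLinearMap.mul ℂ A
  mul_act a b y := by simp [mul_assoc]

variable {A}

/-- A bounded linear map is a morphism of left Banach `A`-modules. -/
def IsModuleMorphism {X Y : Type*} [NormedAddCommGroup X] [NormedSpace ℂ X]
    [NormedAddCommGroup Y] [NormedSpace ℂ Y] (mX : LeftBanachModule A X)
    (mY : LeftBanachModule A Y) (f : X →L[ℂ] Y) : Prop :=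
  ∀ (a : A) (x : X), f (mX.act a x) = mY.act a (f x)

/-- A left Banach `A`-module `P` is projective: for every left Banach `A`-module `Y`, every morphism
`φ : Y → P` that has a right inverse as a morphism of Banach spaces (so that `φ` is onto) has a
right inverse which is a morphism of left Banach `A`-modules. -/
def LeftBanachModule.IsProjective {P : Type*} [NormedAddCommGroup P] [NormedSpace ℂ P]
    (mP : LeftBanachModule A P) : Prop :=
  ∀ (Y : Type w) [NormedAddCommGroup Y] [NormedSpace ℂ Y] [CompleteSpace Y]
    (mY : LeftBanachModule A Y) (φ : Y →L[ℂ] P), IsModuleMorphism mY mP φ →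
    (∃ σ : P →L[ℂ] Y, ∀ x, φ (σ x) = x) →
    ∃ ψ : P →L[ℂ] Y, IsModuleMorphism mP mY ψ ∧ ∀ x, φ (ψ x) = x

variable (A)

/-- The Banach algebra `A` is left projective: it is projective as a left Banach module over itself
(tested on Banach modules in the universe `w`, which is arbitrary). -/
def IsLeftProjective : Prop :=
  LeftBanachModule.IsProjective.{v, w} (LeftBanachModule.regular A)

/-- The completed projective tensor product `A ⊗̂ A`: the completion of the algebraic tensor product
`A ⊗ A` in the projective norm `‖u‖ = inf {∑ ‖xₖ‖ ‖yₖ‖ : u = ∑ xₖ ⊗ yₖ}`, which is the norm that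
Mathlib puts on `⨂[ℂ] i, Eᵢ`. -/
abbrev ProjTensorSquare : Type v :=
  UniformSpace.Completion (⨂[ℂ] _ : Fin 2, A)

namespace ProjTensorSquare

variable {A}

/-- The elementary tensor `b ⊗ c` in `A ⊗̂ A`. -/
def tmul (b c : A) : ProjTensorSquare A :=
  ((PiTensorProduct.tprod ℂ (fun i : Fin 2 => ![b, c] i) : ⨂[ℂ] _ : Fin 2, A) :
    UniformSpace.Completion (⨂[ℂ] _ : Fin 2, A))

/-- The bounded operator `b ⊗ c ↦ (a b) ⊗ c` on `A ⊗̂ A`. -/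
def leftMul (a : A) : ProjTensorSquare A →L[ℂ] ProjTensorSquare A :=
  (PiTensorProduct.mapL (fun i : Fin 2 =>
    (![ContinuousLinearMap.mul ℂ A a, ContinuousLinearMap.id ℂ A] i : A →L[ℂ] A))).completion

theorem leftMul_tmul (a b c : A) : leftMul a (tmul b c) = tmul (a * b) c := by
  unfold leftMul tmul
  rw [ContinuousLinearMap.completion_apply_coe, PiTensorProduct.mapL_apply,
    PiTensorProduct.map_tprod]
  congr 2
  funext i
  fin_cases i <;> simp

/-- The multiplication of `A` as a bounded `2`-linear map. -/
def mulMultilinear : ContinuousMultilinearMap ℂ (fun _ : Fin 2 => A) A :=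
  MultilinearMap.mkContinuous
    (MultilinearMap.mk' (fun m : Fin 2 → A => m 0 * m 1)
      (by intro m i x y; fin_cases i <;> simp [add_mul, mul_add])
      (by intro m i c x; fin_cases i <;> simp [smul_mul_assoc, mul_smul_comm]))
    1 (fun m => by simpa using norm_mul_le (m 0) (m 1))

variable [CompleteSpace A]

/-- The canonical morphism `π : A ⊗̂ A → A`, `b ⊗ c ↦ b c`. -/
def mulMap : ProjTensorSquare A →L[ℂ] A :=
  (PiTensorProduct.liftIsometry ℂ (fun _ : Fin 2 => A) A mulMultilinear).fromCompletion

theorem mulMap_tmul (b c : A) : mulMap (tmul b c) = b * c := by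
  unfold mulMap tmul
  rw [ContinuousLinearMap.fromCompletion_apply_coe, PiTensorProduct.liftIsometry_apply_apply,
    PiTensorProduct.lift.tprod]
  simp [mulMultilinear]

end ProjTensorSquare

end BanachModules

/-! ### Strictly positive elements -/

/-- An element `h` of a C⋆-algebra is strictly positive: it is positive, and `f h > 0` for every
non-zero positive linear functional `f`. -/
def IsStrictlyPositiveElement {A : Type*} [NonUnitalCStarAlgebra A] (h : A) : Prop :=
  (∃ b : A, h = star b * b) ∧
    ∀ f : A →ₗ[ℂ] ℂ, (∀ b : A, 0 ≤ (f (star b * b)).re ∧ (f (star b * b)).im = 0) → f ≠ 0 →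
      0 < (f h).re

/-! ### Topological dimension -/

/-- `dim Ω ≤ n`: every locally finite open cover of `Ω` has a locally finite open refinement that
covers `Ω` and in which every point lies in at most `n + 1` members. -/
def CoveringDimLE (Ω : Type u) [TopologicalSpace Ω] (n : ℕ) : Prop :=
  ∀ 𝒱 : Set (Set Ω), (∀ V ∈ 𝒱, IsOpen V) → ⋃₀ 𝒱 = univ →
    LocallyFinite (fun V : 𝒱 => (V : Set Ω)) →
    ∃ 𝒲 : Set (Set Ω), (∀ W ∈ 𝒲, IsOpen W) ∧ ⋃₀ 𝒲 = univ ∧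
      LocallyFinite (fun W : 𝒲 => (W : Set Ω)) ∧ (∀ W ∈ 𝒲, ∃ V ∈ 𝒱, W ⊆ V) ∧
      ∀ x : Ω, {W ∈ 𝒲 | x ∈ W}.encard ≤ (n : ℕ∞) + 1

/-! ### Continuous fields of C⋆-algebras -/

/-- A continuous field of C⋆-algebras over `Ω` with fibres `A t`. -/
structure ContinuousField {Ω : Type u} [TopologicalSpace Ω] (A : Ω → Type v)
    [∀ t, NonUnitalCStarAlgebra (A t)] where
  /-- The continuous vector fields: an involutive subalgebra of the product of the fibres. -/
  Θ : NonUnitalStarSubalgebra ℂ (∀ t, A t)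
  dense_eval : ∀ t, Dense {a : A t | ∃ x ∈ Θ, x t = a}
  continuous_norm : ∀ x ∈ Θ, Continuous fun t => ‖x t‖
  mem_of_locally_approx : ∀ x : ∀ t, A t,
    (∀ t, ∀ ε > (0 : ℝ), ∃ x' ∈ Θ, ∀ᶠ s in 𝓝 t, ‖x s - x' s‖ ≤ ε) → x ∈ Θ

namespace ContinuousField

variable {Ω : Type u} [TopologicalSpace Ω] {A : Ω → Type v} [∀ t, NonUnitalCStarAlgebra (A t)]

/-- A vector field `x` over `Y ⊆ Ω` is continuous at `t ∈ Y`. -/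
def ContAt (U : ContinuousField A) (Y : Set Ω) (x : ∀ t : Y, A t) (t : Y) : Prop :=
  ∀ ε > (0 : ℝ), ∃ x' ∈ U.Θ, ∀ᶠ s in 𝓝 t, ‖x s - x' s‖ ≤ ε

theorem ContAt.of_mem (U : ContinuousField A) (Y : Set Ω) {x : ∀ t, A t} (hx : x ∈ U.Θ) (t : Y) :
    U.ContAt Y (fun s => x s) t :=
  fun ε hε => ⟨x, hx, Eventually.of_forall fun s => by simpa using hε.le⟩

theorem eventually_norm_le (U : ContinuousField A) (Y : Set Ω) {x : ∀ t, A t} (hx : x ∈ U.Θ)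
    (t : Y) : ∀ᶠ s : Y in 𝓝 t, ‖x s‖ ≤ ‖x t‖ + 1 := by
  have h : Continuous fun s : Y => ‖x s‖ := (U.continuous_norm x hx).comp continuous_subtype_val
  filter_upwards [h.continuousAt.eventually_lt_const (lt_add_one ‖x t‖)] with s hs using hs.le

theorem ContAt.mul (U : ContinuousField A) (Y : Set Ω) {x y : ∀ t : Y, A t} {t : Y}
    (hx : U.ContAt Y x t) (hy : U.ContAt Y y t) : U.ContAt Y (x * y) t := by
  intro ε hε
  obtain ⟨y₁, hy₁, hyy₁⟩ := hy 1 one_pos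
  have hM : (0 : ℝ) < ‖y₁ t‖ + 2 := by positivity
  obtain ⟨x', hx', hxx'⟩ := hx (ε / 2 / (‖y₁ t‖ + 2)) (by positivity)
  have hN : (0 : ℝ) < ‖x' t‖ + 1 := by positivity
  obtain ⟨y', hy', hyy'⟩ := hy (ε / 2 / (‖x' t‖ + 1)) (by positivity)
  refine ⟨x' * y', mul_mem hx' hy', ?_⟩
  filter_upwards [hyy₁, hxx', hyy', U.eventually_norm_le Y hy₁ t, U.eventually_norm_le Y hx' t]
    with s h1 h2 h3 h4 h5
  have hys : ‖y s‖ ≤ ‖y₁ t‖ + 2 := by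
    have := norm_add_le (y s - y₁ s) (y₁ s)
    rw [sub_add_cancel] at this
    linarith
  have e : (x * y) s - (x' * y') s = (x s - x' s) * y s + x' s * (y s - y' s) := by
    simp only [Pi.mul_apply]
    noncomm_ring
  rw [e]
  calc _ ≤ ‖x s - x' s‖ * ‖y s‖ + ‖x' s‖ * ‖y s - y' s‖ :=
        (norm_add_le _ _).trans (add_le_add (norm_mul_le _ _) (norm_mul_le _ _))
    _ ≤ ε / 2 / (‖y₁ t‖ + 2) * (‖y₁ t‖ + 2) + (‖x' t‖ + 1) * (ε / 2 / (‖x' t‖ + 1)) := by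
        gcongr
    _ = ε := by field_simp; ring

theorem ContAt.add (U : ContinuousField A) (Y : Set Ω) {x y : ∀ t : Y, A t} {t : Y}
    (hx : U.ContAt Y x t) (hy : U.ContAt Y y t) : U.ContAt Y (x + y) t := by
  intro ε hε
  obtain ⟨x', hx', hxx'⟩ := hx (ε / 2) (by positivity)
  obtain ⟨y', hy', hyy'⟩ := hy (ε / 2) (by positivity)
  refine ⟨x' + y', add_mem hx' hy', ?_⟩
  filter_upwards [hxx', hyy'] with s h1 h2
  have e : (x + y) s - (x' + y') s = (x s - x' s) + (y s - y' s) := by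
    simp only [Pi.add_apply]
    abel
  rw [e]
  linarith [norm_add_le (x s - x' s) (y s - y' s)]

theorem ContAt.smul (U : ContinuousField A) (Y : Set Ω) (c : ℂ) {x : ∀ t : Y, A t} {t : Y}
    (hx : U.ContAt Y x t) : U.ContAt Y (c • x) t := by
  intro ε hε
  have hc : (0 : ℝ) < ‖c‖ + 1 := by positivity
  obtain ⟨x', hx', hxx'⟩ := hx (ε / (‖c‖ + 1)) (by positivity)
  refine ⟨c • x', SMulMemClass.smul_mem c hx', ?_⟩
  filter_upwards [hxx'] with s h1
  simp only [Pi.smul_apply]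
  rw [← smul_sub, norm_smul]
  calc ‖c‖ * ‖x s - x' s‖ ≤ (‖c‖ + 1) * (ε / (‖c‖ + 1)) := by gcongr; linarith
    _ = ε := by field_simp

theorem ContAt.star (U : ContinuousField A) (Y : Set Ω) {x : ∀ t : Y, A t} {t : Y}
    (hx : U.ContAt Y x t) : U.ContAt Y (star x) t := by
  intro ε hε
  obtain ⟨x', hx', hxx'⟩ := hx ε hε
  refine ⟨Star.star x', star_mem hx', ?_⟩
  filter_upwards [hxx'] with s h1
  simp only [Pi.star_apply]
  rwa [← star_sub, norm_star]

/-- The field induced by `U` on `Y ⊆ Ω`; its continuous vector fields are the vector fields over `Y`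
that are continuous at every point of `Y`. -/
def restrict (U : ContinuousField A) (Y : Set Ω) : ContinuousField (fun t : Y => A t) where
  Θ :=
    { carrier := {x | ∀ t : Y, U.ContAt Y x t}
      add_mem' := fun hx hy t => (hx t).add U Y (hy t)
      zero_mem' := fun t => ContAt.of_mem U Y (zero_mem U.Θ) t
      mul_mem' := fun hx hy t => (hx t).mul U Y (hy t)
      smul_mem' := fun c _ hx t => (hx t).smul U Y c
      star_mem' := fun hx t => (hx t).star U Y }
  dense_eval t := by
    refine (U.dense_eval t).mono ?_
    rintro _ ⟨x, hx, rfl⟩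
    exact ⟨fun s => x s, fun s => ContAt.of_mem U Y hx s, rfl⟩
  continuous_norm x hx := by
    rw [continuous_iff_continuousAt]
    intro t
    rw [ContinuousAt, Metric.tendsto_nhds]
    intro ε hε
    obtain ⟨x', hx', h⟩ := hx t (ε / 4) (by positivity)
    have hc : Continuous fun s : Y => ‖x' s‖ :=
      (U.continuous_norm x' hx').comp continuous_subtype_val
    have ht := h.self_of_nhds
    filter_upwards [h, (Metric.tendsto_nhds.1 hc.continuousAt) (ε / 4) (by positivity)]
      with s h1 h2
    rw [Real.dist_eq] at h2 ⊢
    have a1 := abs_norm_sub_norm_le (x s) (x' s)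
    have a2 := abs_norm_sub_norm_le (x t) (x' t)
    rw [abs_lt] at h2 ⊢
    rw [abs_le] at a1 a2
    constructor <;> linarith [a1.1, a1.2, a2.1, a2.2, h2.1, h2.2]
  mem_of_locally_approx x hx t ε hε := by
    obtain ⟨y, hy, h⟩ := hx t (ε / 2) (by positivity)
    obtain ⟨x', hx', h'⟩ := hy t (ε / 2) (by positivity)
    refine ⟨x', hx', ?_⟩
    filter_upwards [h, h'] with s h1 h2
    have := norm_add_le (x s - y s) (y s - x' s)
    rw [sub_add_sub_cancel] at this
    linarith

/-- The constant field over `Ω` defined by a C⋆-algebra `B`: its continuous vector fields are the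
continuous maps `Ω → B`. -/
def const (Ω : Type u) [TopologicalSpace Ω] (B : Type v) [NonUnitalCStarAlgebra B] :
    ContinuousField (fun _ : Ω => B) where
  Θ :=
    { carrier := {x | Continuous x}
      add_mem' := fun hx hy => Continuous.add hx hy
      zero_mem' := continuous_const
      mul_mem' := fun hx hy => Continuous.mul hx hy
      smul_mem' := fun c _ hx => Continuous.const_smul hx c
      star_mem' := fun hx => Continuous.star hx }
  dense_eval t := by
    refine dense_univ.mono ?_
    intro b _
    exact ⟨fun _ => b, continuous_const, rfl⟩
  continuous_norm x hx := Continuous.norm hx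
  mem_of_locally_approx x hx := by
    refine continuous_iff_continuousAt.2 fun t => ?_
    rw [ContinuousAt, Metric.tendsto_nhds]
    intro ε hε
    obtain ⟨x', hx', h⟩ := hx t (ε / 4) (by positivity)
    have hc : Continuous x' := hx'
    have ht := h.self_of_nhds
    filter_upwards [h, (Metric.tendsto_nhds.1 hc.continuousAt) (ε / 4) (by positivity)]
      with s h1 h2
    rw [← dist_eq_norm] at h1 ht
    have := dist_triangle4 (x s) (x' s) (x' t) (x t)
    rw [dist_comm (x' t)] at this
    linarith

/-- An isomorphism of two continuous fields over `Ω`: a family of `*`-isomorphisms of the fibres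
(which are automatically isometric) that carries the continuous vector fields of the first onto
those of the second. -/
structure Iso {A' : Ω → Type w} [∀ t, NonUnitalCStarAlgebra (A' t)] (U : ContinuousField A)
    (U' : ContinuousField A') where
  φ : ∀ t, A t ≃⋆ₐ[ℂ] A' t
  mem_iff : ∀ x : ∀ t, A t, x ∈ U.Θ ↔ (fun t => φ t (x t)) ∈ U'.Θ

/-- A field is trivial if it is isomorphic to a constant field. -/
def IsTrivial (U : ContinuousField A) : Prop :=
  ∃ (B : Type v) (_ : NonUnitalCStarAlgebra B), Nonempty (U.Iso (const Ω B))

/-- Every point has an open neighbourhood on which the field is trivial. -/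
def IsLocallyTrivial (U : ContinuousField A) : Prop :=
  ∀ t, ∃ V : Set Ω, IsOpen V ∧ t ∈ V ∧ (U.restrict V).IsTrivial

/-- `n`-local triviality: there are an open cover `𝒰` of `Ω` with `U` trivial on each member of
`𝒰`, and an open cover `V₁, …, Vₙ` of `Ω` such that each closure of `Vⱼ` is contained in some member
of `𝒰`. -/
def IsNLocallyTrivial (U : ContinuousField A) (n : ℕ) : Prop :=
  ∃ 𝒰 : Set (Set Ω), (∀ W ∈ 𝒰, IsOpen W) ∧ ⋃₀ 𝒰 = univ ∧ (∀ W ∈ 𝒰, (U.restrict W).IsTrivial) ∧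
    ∃ V : Fin n → Set Ω, (∀ j, IsOpen (V j)) ∧ ⋃ j, V j = univ ∧
      ∀ j, ∃ W ∈ 𝒰, closure (V j) ⊆ W

/-- The C⋆-algebra defined by the field `U`: the continuous vector fields `x` for which `‖x t‖`
vanishes at infinity on `Ω`, with the supremum norm and the pointwise operations.  Such `x` are
bounded (see `exists_mem_sectionAlgebra`), and so the algebra is a subalgebra of the C⋆-algebra
`lp A ∞` of all bounded vector fields. -/
def sectionAlgebra (U : ContinuousField A) : NonUnitalStarSubalgebra ℂ (lp A ∞) where
  carrier := {x | (fun t => x t) ∈ U.Θ ∧ Tendsto (fun t => ‖x t‖) (cocompact Ω) (𝓝 0)}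
  add_mem' := by
    rintro x y ⟨hx, hx0⟩ ⟨hy, hy0⟩
    refine ⟨add_mem hx hy, ?_⟩
    refine squeeze_zero (fun t => norm_nonneg _) (fun t => norm_add_le (x t) (y t)) ?_
    simpa using hx0.add hy0
  zero_mem' := ⟨zero_mem U.Θ, by simpa using tendsto_const_nhds⟩
  mul_mem' := by
    rintro x y ⟨hx, hx0⟩ ⟨hy, hy0⟩
    refine ⟨mul_mem hx hy, ?_⟩
    refine squeeze_zero (fun t => norm_nonneg _) (fun t => norm_mul_le (x t) (y t)) ?_
    simpa using hx0.mul hy0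
  smul_mem' := by
    rintro c x ⟨hx, hx0⟩
    refine ⟨SMulMemClass.smul_mem c hx, ?_⟩
    simp only [lp.coeFn_smul, Pi.smul_apply, norm_smul]
    simpa using hx0.const_mul ‖c‖
  star_mem' := by
    rintro x ⟨hx, hx0⟩
    refine ⟨star_mem (s := U.Θ) hx, ?_⟩
    simpa using hx0

theorem mem_sectionAlgebra (U : ContinuousField A) (x : lp A ∞) : x ∈ U.sectionAlgebra ↔
    (fun t => x t) ∈ U.Θ ∧ Tendsto (fun t => ‖x t‖) (cocompact Ω) (𝓝 0) :=
  Iff.rfl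

/-- The supremum norm of the algebra of sections. -/
theorem norm_sectionAlgebra (U : ContinuousField A) (x : U.sectionAlgebra) :
    ‖x‖ = ⨆ t, ‖(x : lp A ∞) t‖ :=
  lp.norm_eq_ciSup (x : lp A ∞)

/-- Every continuous vector field that vanishes at infinity is an element of the algebra. -/
theorem exists_mem_sectionAlgebra (U : ContinuousField A) (x : ∀ t, A t) (hx : x ∈ U.Θ)
    (hx0 : Tendsto (fun t => ‖x t‖) (cocompact Ω) (𝓝 0)) :
    ∃ y : U.sectionAlgebra, ∀ t, (y : lp A ∞) t = x t := by
  have hb : Memℓp x ∞ := by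
    refine memℓp_infty ?_
    obtain ⟨K, hK, h⟩ := mem_cocompact.1 (hx0.eventually_lt_const one_pos)
    obtain ⟨M, hM⟩ := (hK.image (U.continuous_norm x hx)).bddAbove
    refine ⟨max M 1, ?_⟩
    rintro _ ⟨t, rfl⟩
    by_cases ht : t ∈ K
    · exact le_max_of_le_left (hM ⟨t, ht, rfl⟩)
    · exact le_max_of_le_right (le_of_lt (h ht))
  exact ⟨⟨⟨x, hb⟩, hx, hx0⟩, fun t => rfl⟩

/-- The algebra of sections is closed in the algebra of all bounded vector fields, so that it is a
C⋆-algebra. -/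
instance isClosed_sectionAlgebra (U : ContinuousField A) :
    IsClosed (U.sectionAlgebra : Set (lp A ∞)) := by
  refine isClosed_of_closure_subset fun x hx => ?_
  have key : ∀ ε > (0 : ℝ), ∃ y ∈ U.sectionAlgebra, ∀ t, ‖x t - y t‖ ≤ ε := by
    intro ε hε
    obtain ⟨y, hy, h⟩ := Metric.mem_closure_iff.1 hx ε hε
    refine ⟨y, hy, fun t => ?_⟩
    rw [dist_eq_norm] at h
    exact (lp.norm_apply_le_norm ENNReal.top_ne_zero (x - y) t).trans h.le
  refine ⟨U.mem_of_locally_approx _ fun t ε hε => ?_, ?_⟩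
  · obtain ⟨y, hy, h⟩ := key ε hε
    exact ⟨fun s => y s, hy.1, Eventually.of_forall h⟩
  · rw [Metric.tendsto_nhds]
    intro ε hε
    obtain ⟨y, hy, h⟩ := key (ε / 2) (by positivity)
    filter_upwards [hy.2.eventually_lt_const (show (0 : ℝ) < ε / 2 by positivity)] with t ht
    have := norm_add_le (x t - y t) (y t)
    rw [sub_add_cancel] at this
    simp only [dist_zero_right, norm_norm]
    linarith [h t]

end ContinuousField

end

/-! A family `f` of which all signed sums `∑ ± f k` have norm at most `C` satisfies
`‖∑ B (a * f k) (f k)‖ ≤ ‖B‖ * C ^ 2 * ‖a‖` for every bounded bilinear map `B`, because the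
diagonal sum is the average over all choices of signs of `B` applied to two signed sums.  If
moreover `∑ a * f k * f k = a`, then `a ↦ ∑ a * f k ⊗ f k` splits the multiplication, and
`a ↦ ∑ (a * f k) · σ (f k)` is a module morphism whenever `σ` is a bounded right inverse.

Such a family with `C = √2` exists as soon as one continuous vector field `x` is strictly positive
in every fibre; local trivializations and a partition of unity provide `x`.  Since `Ω` is a disjoint
union of open `σ`-compact pieces, scalar functions that vanish at infinity turn `x` into sections
`h i` of which exactly one is alive at each point.  The family consists of the square roots of the
differences of consecutive cut-offs of the `h i` away from `0`: at most two of these functions are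
non-zero at any given real number, and their squares add up to at most `1`.  The cut-offs are an
approximate unit, in each fibre by the Hahn–Banach theorem and then uniformly by Dini's theorem. -/

noncomputable section

section SignedSums

variable {𝕜 κ V : Type*} [RCLike 𝕜] [NormedAddCommGroup V]

/-- The finite sums of the family `x` with arbitrary signs are bounded by `C`; this is the
quantitative form of weak unconditional summability. -/
def SignedSumsBounded (x : κ → V) (C : ℝ) : Prop :=
  ∀ (F : Finset κ) (ε : κ → ℤˣ), ‖∑ k ∈ F, ε k • x k‖ ≤ C

theorem norm_add_smul_add_sum_le [DecidableEq κ] {F : Finset κ} {k₀ : κ} (hk₀ : k₀ ∉ F)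
    {x₀ : V} {x : κ → V} {C : ℝ}
    (hx : ∀ ε : κ → ℤˣ, ‖x₀ + ∑ k ∈ insert k₀ F, ε k • x k‖ ≤ C) (s : ℤˣ) (ε : κ → ℤˣ) :
    ‖x₀ + s • x k₀ + ∑ k ∈ F, ε k • x k‖ ≤ C := by
  have hsum : ∑ k ∈ F, Function.update ε k₀ s k • x k = ∑ k ∈ F, ε k • x k :=
    Finset.sum_congr rfl fun k hk => by
      rw [Function.update_of_ne (ne_of_mem_of_not_mem hk hk₀)]
  simpa only [Finset.sum_insert hk₀, Function.update_self, hsum, add_assoc] using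
    hx (Function.update ε k₀ s)

variable {X Y Z : Type*} [NormedAddCommGroup X] [NormedSpace 𝕜 X]
  [NormedAddCommGroup Y] [NormedSpace 𝕜 Y] [NormedAddCommGroup Z] [NormedSpace 𝕜 Z]

-- The diagonal sum is the average over all signs of `B (x₀ + ∑ εₖ xₖ) (y₀ + ∑ εₖ yₖ)`.
theorem norm_apply_add_sum_apply_le (B : X →L[𝕜] Y →L[𝕜] Z) (x : κ → X) (y : κ → Y) {C D : ℝ}
    (F : Finset κ) (x₀ : X) (y₀ : Y)
    (hx : ∀ ε : κ → ℤˣ, ‖x₀ + ∑ k ∈ F, ε k • x k‖ ≤ C)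
    (hy : ∀ ε : κ → ℤˣ, ‖y₀ + ∑ k ∈ F, ε k • y k‖ ≤ D) :
    ‖B x₀ y₀ + ∑ k ∈ F, B (x k) (y k)‖ ≤ ‖B‖ * C * D := by
  classical
  induction F using Finset.induction_on generalizing x₀ y₀ with
  | empty =>
    simp only [Finset.sum_empty, add_zero, forall_const] at hx hy ⊢
    have : 0 ≤ C := (norm_nonneg _).trans hx
    exact (B.le_opNorm₂ x₀ y₀).trans (by gcongr)
  | insert k₀ F hk₀ ih =>
    have hsign (s : ℤˣ) := ih _ _ (norm_add_smul_add_sum_le hk₀ hx s)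
      (norm_add_smul_add_sum_le hk₀ hy s)
    have hplus := hsign 1
    have hminus := hsign (-1)
    simp only [one_smul, Units.neg_smul] at hplus hminus
    rw [Finset.sum_insert hk₀]
    set S := ∑ k ∈ F, B (x k) (y k)
    have average : B x₀ y₀ + (B (x k₀) (y k₀) + S) =
        (2⁻¹ : 𝕜) • ((B (x₀ + x k₀) (y₀ + y k₀) + S) + (B (x₀ + -x k₀) (y₀ + -y k₀) + S)) := by
      simp only [map_add, map_neg, add_apply, neg_apply]
      module
    rw [average, norm_smul, norm_inv, RCLike.norm_ofNat]
    linarith [norm_add_le (B (x₀ + x k₀) (y₀ + y k₀) + S) (B (x₀ + -x k₀) (y₀ + -y k₀) + S)]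

namespace SignedSumsBounded

theorem norm_sum_apply_le {x : κ → X} {y : κ → Y} {C D : ℝ} (hx : SignedSumsBounded x C)
    (hy : SignedSumsBounded y D) (B : X →L[𝕜] Y →L[𝕜] Z) (F : Finset κ) :
    ‖∑ k ∈ F, B (x k) (y k)‖ ≤ ‖B‖ * C * D := by
  simpa using norm_apply_add_sum_apply_le B x y F 0 0 (fun ε => by simpa using hx F ε)
    (fun ε => by simpa using hy F ε)

theorem mul_left {A : Type*} [NonUnitalNormedRing A] {x : κ → A} {C : ℝ}
    (hx : SignedSumsBounded x C) (a : A) : SignedSumsBounded (fun k => a * x k) (‖a‖ * C) := by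
  intro F ε
  simp_rw [← mul_smul_comm, ← Finset.mul_sum]
  exact (norm_mul_le _ _).trans (by gcongr; exact hx F ε)

theorem of_comp_injective {κ' : Type*} {x : κ → V} {C : ℝ} {e : κ' → κ}
    (he : Function.Injective e) (hx : SignedSumsBounded (x ∘ e) C)
    (hzero : ∀ k ∉ Set.range e, x k = 0) : SignedSumsBounded x C := by
  intro F ε
  rw [← Finset.sum_preimage e F he.injOn _ fun k _ hk => by rw [hzero k hk, smul_zero]]
  exact hx _ (ε ∘ e)

end SignedSumsBounded

end SignedSums

section DiagonalFamily

variable {𝕜 κ A Z : Type*} [RCLike 𝕜] [NonUnitalNormedRing A] [NormedSpace 𝕜 A]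
  [NormedAddCommGroup Z] [NormedSpace 𝕜 Z] {f : κ → A} {C : ℝ}

/-- A family of which `∑ f k ⊗ f k` is an approximate diagonal of `A` on the right: signed sums are
bounded by `C`, and `∑ a * f k * f k = a` is a finite sum for the elements `a` of a dense set. -/
structure IsDiagonalFamily (f : κ → A) (C : ℝ) : Prop where
  signedSumsBounded : SignedSumsBounded f C
  dense : Dense {a : A | ∃ F : Finset κ, (∀ k ∉ F, a * f k = 0) ∧ ∑ k ∈ F, a * f k * f k = a}

namespace IsDiagonalFamily

theorem norm_sum_apply_le (hf : IsDiagonalFamily f C) (B : A →L[𝕜] A →L[𝕜] Z) (a : A)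
    (F : Finset κ) : ‖∑ k ∈ F, B (a * f k) (f k)‖ ≤ ‖B‖ * C ^ 2 * ‖a‖ :=
  ((hf.signedSumsBounded.mul_left a).norm_sum_apply_le hf.signedSumsBounded B F).trans_eq
    (by ring)

theorem summable_apply [CompleteSpace Z] (hf : IsDiagonalFamily f C) (B : A →L[𝕜] A →L[𝕜] Z)
    (a : A) : Summable fun k => B (a * f k) (f k) := by
  refine summable_iff_vanishing_norm.2 fun ε hε => ?_
  obtain ⟨d, ⟨F₀, hF₀, -⟩, had⟩ := hf.dense.exists_dist_lt a
    (show 0 < ε / (‖B‖ * C ^ 2 + 1) by positivity)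
  refine ⟨F₀, fun F hF => ?_⟩
  have tail : ∑ k ∈ F, B (a * f k) (f k) = ∑ k ∈ F, B ((a - d) * f k) (f k) :=
    Finset.sum_congr rfl fun k hk => by
      rw [sub_mul, hF₀ k (Finset.disjoint_left.1 hF hk), sub_zero]
  rw [dist_eq_norm, lt_div_iff₀' (by positivity)] at had
  calc ‖∑ k ∈ F, B (a * f k) (f k)‖ ≤ ‖B‖ * C ^ 2 * ‖a - d‖ := tail ▸ hf.norm_sum_apply_le B _ F
    _ ≤ (‖B‖ * C ^ 2 + 1) * ‖a - d‖ := by gcongr; linarith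
    _ < ε := had

variable [IsScalarTower 𝕜 A A] [CompleteSpace Z]

/-- The bounded operator `a ↦ ∑' k, B (a * f k) (f k)`. -/
def diagonalSum (hf : IsDiagonalFamily f C) (B : A →L[𝕜] A →L[𝕜] Z) : A →L[𝕜] Z :=
  LinearMap.mkContinuous
    { toFun := fun a => ∑' k, B (a * f k) (f k)
      map_add' := fun a b => by
        simpa [add_mul] using (hf.summable_apply B a).tsum_add (hf.summable_apply B b)
      map_smul' := fun c a => by
        simpa [smul_mul_assoc] using (hf.summable_apply B a).tsum_const_smul c }
    (‖B‖ * C ^ 2)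
    fun a => le_of_tendsto (hf.summable_apply B a).hasSum.norm
      (Eventually.of_forall (hf.norm_sum_apply_le B a))

theorem hasSum_diagonalSum (hf : IsDiagonalFamily f C) (B : A →L[𝕜] A →L[𝕜] Z) (a : A) :
    HasSum (fun k => B (a * f k) (f k)) (hf.diagonalSum B a) :=
  (hf.summable_apply B a).hasSum

theorem norm_diagonalSum_le (hf : IsDiagonalFamily f C) {B : A →L[𝕜] A →L[𝕜] Z} {K : ℝ}
    (hK : 0 ≤ K) (hB : ∀ a b, ‖B a b‖ ≤ K * ‖a‖ * ‖b‖) : ‖hf.diagonalSum B‖ ≤ K * C ^ 2 :=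
  (LinearMap.mkContinuous_norm_le _ (by positivity) _).trans
    (by gcongr; exact B.opNorm_le_bound₂ hK hB)

variable (𝕜) in
theorem hasSum_mul_mul [SMulCommClass 𝕜 A A] [CompleteSpace A] (hf : IsDiagonalFamily f C)
    (a : A) : HasSum (fun k => a * f k * f k) a := by
  have hsum := hf.hasSum_diagonalSum (ContinuousLinearMap.mul 𝕜 A)
  have identity : ⇑(hf.diagonalSum (ContinuousLinearMap.mul 𝕜 A)) = id := by
    refine (ContinuousLinearMap.continuous _).ext_on hf.dense continuous_id ?_
    rintro d ⟨F, hF, hd⟩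
    refine ((hsum d).unique (hasSum_sum_of_ne_finset_zero fun k hk => ?_)).trans hd
    rw [hF k hk, map_zero, zero_apply]
  exact (congrFun identity a).subst (motive := HasSum _) (hsum a)

end IsDiagonalFamily

end DiagonalFamily

section Projectivity

namespace ProjTensorSquare

variable {A : Type v} [NonUnitalNormedRing A] [NormedSpace ℂ A]

theorem norm_tmul_le (b c : A) : ‖tmul b c‖ ≤ ‖b‖ * ‖c‖ := by
  rw [tmul, UniformSpace.Completion.norm_coe]
  simpa [Fin.prod_univ_two] using
    PiTensorProduct.projectiveSeminorm_tprod_le (𝕜 := ℂ) fun i : Fin 2 => ![b, c] i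

variable (A) in
/-- The elementary tensor `b ⊗ c` as a bounded bilinear map. -/
def tmulL : A →L[ℂ] A →L[ℂ] ProjTensorSquare A :=
  (continuousMultilinearCurryFin1 ℂ A (ProjTensorSquare A) :
      ContinuousMultilinearMap ℂ (fun _ : Fin 1 => A) _ →L[ℂ] A →L[ℂ] ProjTensorSquare A) ∘L
    (UniformSpace.Completion.toComplL.compContinuousMultilinearMap
      (PiTensorProduct.tprodL ℂ (E := fun _ : Fin 2 => A))).curryLeft

theorem tmulL_apply (b c : A) : tmulL A b c = tmul b c := by
  have hcons : (Fin.cons b (Fin.snoc 0 c) : Fin 2 → A) = fun i => ![b, c] i := by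
    funext i
    fin_cases i <;> rfl
  rw [tmul, ← hcons]
  rfl

end ProjTensorSquare

variable {A : Type v} [NonUnitalNormedRing A] [NormedSpace ℂ A] [IsScalarTower ℂ A A]
  [SMulCommClass ℂ A A] [CompleteSpace A] {κ : Type*} {f : κ → A} {C : ℝ}

theorem IsDiagonalFamily.exists_splitting (hf : IsDiagonalFamily f C) :
    ∃ ρ : A →L[ℂ] ProjTensorSquare A,
      (∀ a b : A, ρ (a * b) = ProjTensorSquare.leftMul a (ρ b)) ∧
      (∀ a : A, ProjTensorSquare.mulMap (ρ a) = a) ∧ ‖ρ‖ ≤ C ^ 2 := by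
  have hρ := hf.hasSum_diagonalSum (ProjTensorSquare.tmulL A)
  simp only [ProjTensorSquare.tmulL_apply] at hρ
  refine ⟨hf.diagonalSum (ProjTensorSquare.tmulL A), fun a b => (hρ (a * b)).unique ?_,
    fun a => HasSum.unique ?_ (hf.hasSum_mul_mul ℂ a), ?_⟩
  · simpa only [ProjTensorSquare.leftMul_tmul, mul_assoc] using
      (ProjTensorSquare.leftMul a).hasSum (hρ b)
  · simpa only [ProjTensorSquare.mulMap_tmul] using ProjTensorSquare.mulMap.hasSum (hρ a)
  · simpa only [one_mul] using hf.norm_diagonalSum_le zero_le_one fun b c => by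
      simpa only [ProjTensorSquare.tmulL_apply, one_mul] using ProjTensorSquare.norm_tmul_le b c

theorem IsDiagonalFamily.isLeftProjective (hf : IsDiagonalFamily f C) :
    IsLeftProjective.{v, w} A := by
  intro Y _ _ _ mY φ hφ ⟨σ, hσ⟩
  have hψ := hf.hasSum_diagonalSum ((ContinuousLinearMap.compL ℂ A Y Y).flip σ ∘L mY.act)
  simp only [ContinuousLinearMap.comp_apply, ContinuousLinearMap.flip_apply,
    ContinuousLinearMap.compL_apply] at hψ
  refine ⟨hf.diagonalSum _, fun a b => (hψ (a * b)).unique ?_,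
    fun a => HasSum.unique ?_ (hf.hasSum_mul_mul ℂ a)⟩
  · simpa only [mY.mul_act, mul_assoc] using (mY.act a).hasSum (hψ b)
  · have hφψ := φ.hasSum (hψ a)
    simp only [hφ _ _, hσ] at hφψ
    exact hφψ

end Projectivity

section StrictlyPositive

variable {A : Type*} [NonUnitalCStarAlgebra A]

theorem exists_complexLinear_eq_of_isSelfAdjoint (g : A →ₗ[ℝ] ℝ) :
    ∃ f : A →ₗ[ℂ] ℂ, ∀ x : A, IsSelfAdjoint x → f x = g x := by
  let reg : A →ₗ[ℝ] ℝ :=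
    { toFun := fun x => g (realPart x : A)
      map_add' := fun x y => by simp
      map_smul' := fun c x => by simp }
  refine ⟨Module.Dual.extendRCLike reg, fun x hx => ?_⟩
  have hre : reg x = g x := congrArg g hx.coe_realPart
  have him : reg (Complex.I • x) = 0 := by
    simp [reg, realPart_I_smul, hx.imaginaryPart]
  simp [Module.Dual.extendRCLike_apply, hre, him]

attribute [local instance] CStarAlgebra.spectralOrder CStarAlgebra.spectralOrderedRing in
theorem norm_sub_mul_sq_le {e : A} (he : IsSelfAdjoint e) (he_norm : ‖e‖ ≤ 1) (a b h : A)
    (c : ℝ) :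
    ‖a - a * e‖ ^ 2 ≤ 4 * ‖star a * a + star b * b + c • h‖ + 2 * |c| * ‖h - h * e‖ := by
  have left (x : A) : ‖x - e * x‖ ≤ 2 * ‖x‖ := by
    have : ‖e * x‖ ≤ ‖x‖ := (norm_mul_le e x).trans (mul_le_of_le_one_left (norm_nonneg x) he_norm)
    linarith [norm_sub_le x (e * x)]
  have right (x : A) : ‖x - x * e‖ ≤ 2 * ‖x‖ := by
    have : ‖x * e‖ ≤ ‖x‖ := (norm_mul_le x e).trans (mul_le_of_le_one_right (norm_nonneg x) he_norm)
    linarith [norm_sub_le x (x * e)]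
  set z := star a * a + star b * b + c • h with hz
  have compression : star (a - a * e) * (a - a * e) + star (b - b * e) * (b - b * e) =
      (z - z * e - e * (z - z * e)) - c • (h - h * e - e * (h - h * e)) := by
    simp only [hz, star_sub, star_mul, he.star_eq, smul_sub, mul_add, add_mul, mul_sub, sub_mul,
      smul_mul_assoc, mul_smul_comm, mul_assoc]
    abel
  calc ‖a - a * e‖ ^ 2 = ‖star (a - a * e) * (a - a * e)‖ := by
        rw [CStarRing.norm_star_mul_self, sq]
    _ ≤ ‖star (a - a * e) * (a - a * e) + star (b - b * e) * (b - b * e)‖ :=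
        CStarAlgebra.norm_le_norm_of_nonneg_of_le (star_mul_self_nonneg _)
          (le_add_of_nonneg_right (star_mul_self_nonneg _))
    _ ≤ ‖z - z * e - e * (z - z * e)‖ + |c| * ‖h - h * e - e * (h - h * e)‖ := by
        rw [compression, ← Real.norm_eq_abs, ← norm_smul]
        exact norm_sub_le _ _
    _ ≤ 2 * (2 * ‖z‖) + |c| * (2 * ‖h - h * e‖) := by
        gcongr
        · exact (left _).trans (by gcongr; exact right z)
        · exact left _
    _ = _ := by ring

namespace IsStrictlyPositiveElement

variable {h : A}

theorem isSelfAdjoint (hh : IsStrictlyPositiveElement h) : IsSelfAdjoint h := by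
  obtain ⟨b, rfl⟩ := hh.1
  exact IsSelfAdjoint.star_mul_self b

theorem map {B : Type*} [NonUnitalCStarAlgebra B] (hh : IsStrictlyPositiveElement h)
    (φ : A ≃⋆ₐ[ℂ] B) : IsStrictlyPositiveElement (φ h) := by
  obtain ⟨⟨b, rfl⟩, hpos⟩ := hh
  refine ⟨⟨φ b, by rw [map_mul, map_star]⟩, fun f hf hf0 => ?_⟩
  refine hpos (f ∘ₗ (φ : A →ₗ[ℂ] B)) (fun b => ?_) fun hfφ => hf0 ?_
  · simpa [map_star] using hf (φ b)
  · ext x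
    simpa using LinearMap.congr_fun hfφ (φ.symm x)

theorem smul (hh : IsStrictlyPositiveElement h) {c : ℝ} (hc : 0 < c) :
    IsStrictlyPositiveElement (c • h) := by
  obtain ⟨⟨b, rfl⟩, hpos⟩ := hh
  refine ⟨⟨√c • b, ?_⟩, fun f hf hf0 => ?_⟩
  · rw [star_smul, star_trivial √c, smul_mul_smul_comm, Real.mul_self_sqrt hc.le]
  · rw [← Complex.coe_smul, map_smul, smul_eq_mul, Complex.re_ofReal_mul]
    exact mul_pos hc (hpos f hf hf0)

attribute [local instance] CStarAlgebra.spectralOrder CStarAlgebra.spectralOrderedRing in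
theorem add {k : A} (hh : IsStrictlyPositiveElement h) (hk : IsStrictlyPositiveElement k) :
    IsStrictlyPositiveElement (h + k) := by
  refine ⟨CStarAlgebra.nonneg_iff_eq_star_mul_self.1 (add_nonneg
    (CStarAlgebra.nonneg_iff_eq_star_mul_self.2 hh.1)
    (CStarAlgebra.nonneg_iff_eq_star_mul_self.2 hk.1)), fun f hf hf0 => ?_⟩
  rw [map_add, Complex.add_re]
  exact add_pos (hh.2 f hf hf0) (hk.2 f hf hf0)

theorem sum {ι : Type*} {s : Finset ι} (hs : s.Nonempty) {h : ι → A}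
    (hh : ∀ i ∈ s, IsStrictlyPositiveElement (h i)) :
    IsStrictlyPositiveElement (∑ i ∈ s, h i) :=
  Finset.sum_induction_nonempty h _ (fun _ _ => add) hs hh

attribute [local instance] CStarAlgebra.spectralOrder CStarAlgebra.spectralOrderedRing in
-- Otherwise Hahn–Banach yields a positive functional that vanishes at `h` but not at `star a * a`.
theorem exists_norm_add_add_smul_lt (hh : IsStrictlyPositiveElement h) (a : A) {ε : ℝ}
    (hε : 0 < ε) : ∃ (b : A) (c : ℝ), ‖star a * a + star b * b + c • h‖ < ε := by
  let cone : PointedCone ℝ A := PointedCone.positive ℝ A ⊔ PointedCone.ofSubmodule (ℝ ∙ h)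
  suffices hmem : -(star a * a) ∈ (Submodule.closure cone : ProperCone ℝ A) by
    obtain ⟨x, hx, hdist⟩ := Metric.mem_closure_iff.1 hmem ε hε
    obtain ⟨y, hy, z, hz, rfl⟩ := Submodule.mem_sup.1 hx
    obtain ⟨b, rfl⟩ :=
      CStarAlgebra.nonneg_iff_eq_star_mul_self.1 ((PointedCone.mem_positive ℝ A).1 hy)
    obtain ⟨c, rfl⟩ := Submodule.mem_span_singleton.1 hz
    refine ⟨b, c, ?_⟩
    rwa [dist_comm, dist_eq_norm, sub_neg_eq_add, add_comm, ← add_assoc] at hdist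
  by_contra hmem
  obtain ⟨g, hg, hga⟩ := ProperCone.hyperplane_separation_point _ hmem
  have hg_pos (b : A) : 0 ≤ g (star b * b) :=
    hg _ (subset_closure (Submodule.mem_sup_left (star_mul_self_nonneg b)))
  have hg_span (c : ℝ) : 0 ≤ g (c • h) :=
    hg _ (subset_closure (Submodule.mem_sup_right (Submodule.mem_span_singleton.2 ⟨c, rfl⟩)))
  have hgh : g h = 0 := le_antisymm (by simpa using hg_span (-1)) (by simpa using hg_span 1)
  obtain ⟨f, hf⟩ := exists_complexLinear_eq_of_isSelfAdjoint g.toLinearMap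
  have hf_star (b : A) : f (star b * b) = g (star b * b) := hf _ (IsSelfAdjoint.star_mul_self b)
  refine (hh.2 f (fun b => ?_) fun hf0 => ?_).ne' ?_
  · simpa [hf_star] using hg_pos b
  · refine hga.ne ?_
    rw [map_neg, neg_eq_zero]
    simpa [hf0] using (hf_star a).symm
  · simp [hf h hh.isSelfAdjoint, hgh]

theorem tendsto_mul {ι : Type*} {l : Filter ι} {e : ι → A} (hh : IsStrictlyPositiveElement h)
    (he : ∀ i, IsSelfAdjoint (e i)) (he_norm : ∀ i, ‖e i‖ ≤ 1)
    (hlim : Tendsto (fun i => h * e i) l (𝓝 h)) (a : A) :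
    Tendsto (fun i => a * e i) l (𝓝 a) := by
  rw [Metric.tendsto_nhds]
  intro ε hε
  obtain ⟨b, c, hbc⟩ := hh.exists_norm_add_add_smul_lt a (show 0 < ε ^ 2 / 8 by positivity)
  have hsmall : ∀ᶠ i in l, 2 * |c| * ‖h - h * e i‖ < ε ^ 2 / 2 := by
    have := (hlim.const_sub h).norm.const_mul (2 * |c|)
    rw [sub_self, norm_zero, mul_zero] at this
    exact this.eventually_lt_const (by positivity)
  filter_upwards [hsmall] with i hi
  rw [dist_comm, dist_eq_norm]
  refine lt_of_pow_lt_pow_left₀ 2 hε.le ?_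
  linarith [norm_sub_mul_sq_le (he i) (he_norm i) a b h c]

end IsStrictlyPositiveElement

end StrictlyPositive

section Cutoff

/-- Even continuous cut-offs increasing to `1` away from `0`: `cutoff (n + 1)` vanishes for
`|s| ≤ 2⁻ⁿ` and is `1` for `|s| ≥ 2⁻ⁿ⁺¹`. -/
def cutoff : ℕ → ℝ → ℝ
  | 0, _ => 0
  | n + 1, s => max 0 (min 1 (2 ^ n * |s| - 1))

@[fun_prop]
theorem continuous_cutoff (n : ℕ) : Continuous (cutoff n) := by
  cases n with
  | zero => exact continuous_const
  | succ n => unfold cutoff; fun_prop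

@[simp]
theorem cutoff_apply_zero (n : ℕ) : cutoff n 0 = 0 := by
  cases n <;> simp [cutoff]

theorem cutoff_nonneg (n : ℕ) (s : ℝ) : 0 ≤ cutoff n s := by
  cases n <;> simp [cutoff]

theorem cutoff_le_one (n : ℕ) (s : ℝ) : cutoff n s ≤ 1 := by
  cases n <;> simp [cutoff]

theorem cutoff_succ_eq_one {n : ℕ} {s : ℝ} (h : cutoff n s ≠ 0) : cutoff (n + 1) s = 1 := by
  cases n with
  | zero => exact absurd rfl h
  | succ n =>
    have hpos : 1 < 2 ^ n * |s| := by
      by_contra! hle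
      exact h (max_eq_left (min_le_of_right_le (by linarith)))
    have hone : (1 : ℝ) ≤ 2 ^ (n + 1) * |s| - 1 := by rw [pow_succ]; linarith
    simp [cutoff, min_eq_left hone]

theorem cutoff_eq_one_of_lt {n m : ℕ} (hnm : n < m) {s : ℝ} (h : cutoff n s ≠ 0) :
    cutoff m s = 1 := by
  induction m, hnm using Nat.le_induction with
  | base => exact cutoff_succ_eq_one h
  | succ m _ ih => exact cutoff_succ_eq_one (ih ▸ one_ne_zero)

theorem cutoff_le_cutoff_succ (n : ℕ) (s : ℝ) : cutoff n s ≤ cutoff (n + 1) s := by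
  by_cases h : cutoff n s = 0
  · exact h ▸ cutoff_nonneg _ _
  · exact cutoff_succ_eq_one h ▸ cutoff_le_one _ _

theorem cutoff_mul_cutoff {n m : ℕ} (hnm : n < m) (s : ℝ) :
    cutoff n s * cutoff m s = cutoff n s := by
  by_cases h : cutoff n s = 0
  · rw [h, zero_mul]
  · rw [cutoff_eq_one_of_lt hnm h, mul_one]

theorem abs_sub_mul_cutoff_succ_le (n : ℕ) (s : ℝ) :
    |s - s * cutoff (n + 1) s| ≤ 2 * (1 / 2) ^ n := by
  rw [← mul_one_sub, abs_mul, abs_of_nonneg (sub_nonneg.2 (cutoff_le_one _ _))]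
  rcases le_or_gt 2 (2 ^ n * |s|) with hlarge | hsmall
  · have : (1 : ℝ) ≤ 2 ^ n * |s| - 1 := by linarith
    simp [cutoff, min_eq_left this]
  · calc |s| * (1 - cutoff (n + 1) s) ≤ |s| * 1 := by
          gcongr; linarith [cutoff_nonneg (n + 1) s]
      _ ≤ 2 * (1 / 2) ^ n := by
        rw [mul_one, one_div, inv_pow, ← div_eq_mul_inv, le_div_iff₀ (by positivity), mul_comm]
        exact hsmall.le

/-- The square root of the difference of two consecutive cut-offs. -/
def cutoffSqrt (k : ℕ) (s : ℝ) : ℝ := √(cutoff (k + 1) s - cutoff k s)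

@[fun_prop]
theorem continuous_cutoffSqrt (k : ℕ) : Continuous (cutoffSqrt k) := by
  unfold cutoffSqrt; fun_prop

@[simp]
theorem cutoffSqrt_apply_zero (k : ℕ) : cutoffSqrt k 0 = 0 := by simp [cutoffSqrt]

theorem cutoffSqrt_sq (k : ℕ) (s : ℝ) : cutoffSqrt k s ^ 2 = cutoff (k + 1) s - cutoff k s :=
  Real.sq_sqrt (sub_nonneg.2 (cutoff_le_cutoff_succ k s))

theorem cutoff_mul_cutoffSqrt {n k : ℕ} (hnk : n < k) (s : ℝ) :
    cutoff n s * cutoffSqrt k s = 0 := by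
  by_cases h : cutoff n s = 0
  · rw [h, zero_mul]
  · simp [cutoffSqrt, cutoff_eq_one_of_lt hnk h, cutoff_eq_one_of_lt (hnk.trans k.lt_succ_self) h]

theorem le_succ_of_cutoffSqrt_ne_zero {j k : ℕ} {s : ℝ} (hj : cutoffSqrt j s ≠ 0)
    (hk : cutoffSqrt k s ≠ 0) : k ≤ j + 1 := by
  by_contra! hjk
  have hj0 : cutoff (j + 1) s = 0 :=
    (mul_eq_zero.1 (cutoff_mul_cutoffSqrt hjk s)).resolve_right hk
  refine hj (pow_eq_zero_iff two_ne_zero |>.1 (le_antisymm ?_ (sq_nonneg _)))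
  linarith [cutoffSqrt_sq j s, cutoff_nonneg j s]

theorem card_filter_cutoffSqrt_ne_zero_le_two (F : Finset ℕ) (s : ℝ) :
    (F.filter fun k => cutoffSqrt k s ≠ 0).card ≤ 2 := by
  rcases (F.filter fun k => cutoffSqrt k s ≠ 0).eq_empty_or_nonempty with hempty | hne
  · simp [hempty]
  · set m := Finset.min' _ hne
    have hm := (Finset.mem_filter.1 (Finset.min'_mem _ hne)).2
    refine (Finset.card_le_card fun k hk => ?_).trans (Finset.card_le_two (a := m) (b := m + 1))
    have hlower : m ≤ k := Finset.min'_le _ k hk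
    have hupper : k ≤ m + 1 := le_succ_of_cutoffSqrt_ne_zero hm (Finset.mem_filter.1 hk).2
    rw [Finset.mem_insert, Finset.mem_singleton]
    omega

theorem sum_cutoffSqrt_sq_le_one (F : Finset ℕ) (s : ℝ) : ∑ k ∈ F, cutoffSqrt k s ^ 2 ≤ 1 := by
  obtain ⟨n, hF⟩ := F.exists_nat_subset_range
  calc ∑ k ∈ F, cutoffSqrt k s ^ 2 ≤ ∑ k ∈ Finset.range n, cutoffSqrt k s ^ 2 :=
        Finset.sum_le_sum_of_subset_of_nonneg hF fun k _ _ => sq_nonneg _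
    _ = cutoff n s - cutoff 0 s := by
        simp_rw [cutoffSqrt_sq]
        exact Finset.sum_range_sub (fun k => cutoff k s) n
    _ ≤ 1 := by linarith [cutoff_le_one n s, cutoff_nonneg 0 s]

-- At most two terms do not vanish, and their squares have sum at most `1`.
theorem signedSumsBounded_cutoffSqrt_apply (s : ℝ) :
    SignedSumsBounded (fun k => cutoffSqrt k s) √2 := by
  intro F ε
  set G := F.filter fun k => cutoffSqrt k s ≠ 0
  have hsupport : ∑ k ∈ F, ε k • cutoffSqrt k s = ∑ k ∈ G, ε k • cutoffSqrt k s :=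
    (Finset.sum_filter_of_ne fun k _ hk => right_ne_zero_of_smul hk).symm
  have hsq (k : ℕ) : (ε k • cutoffSqrt k s) ^ 2 = cutoffSqrt k s ^ 2 := by
    rcases Int.units_eq_one_or (ε k) with h | h <;> simp [h]
  refine Real.abs_le_sqrt ?_
  calc (∑ k ∈ F, ε k • cutoffSqrt k s) ^ 2 ≤ G.card * ∑ k ∈ G, cutoffSqrt k s ^ 2 := by
        rw [hsupport]
        simpa only [hsq] using
          sq_sum_le_card_mul_sum_sq (s := G) (f := fun k => ε k • cutoffSqrt k s)
    _ ≤ 2 * 1 := by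
        gcongr
        · exact_mod_cast card_filter_cutoffSqrt_ne_zero_le_two F s
        · exact sum_cutoffSqrt_sq_le_one G s
    _ = 2 := mul_one 2

variable {A : Type*} [NonUnitalCStarAlgebra A] {h : A}

theorem signedSumsBounded_cfcₙ_cutoffSqrt (h : A) :
    SignedSumsBounded (fun k => cfcₙ (cutoffSqrt k) h) √2 := by
  intro F ε
  have hsum : ∑ k ∈ F, ε k • cfcₙ (cutoffSqrt k) h =
      cfcₙ (∑ k ∈ F, fun s => ε k • cutoffSqrt k s) h := by
    rw [cfcₙ_sum _ h F (fun k _ => by fun_prop) (by simp)]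
    exact Finset.sum_congr rfl fun k _ => (cfcₙ_smul (ε k) _ h (by fun_prop) (by simp)).symm
  rw [hsum]
  refine norm_cfcₙ_le fun s _ => ?_
  rw [Finset.sum_apply]
  exact signedSumsBounded_cutoffSqrt_apply s F ε

theorem norm_cfcₙ_cutoff_le_one (n : ℕ) (h : A) : ‖cfcₙ (cutoff n) h‖ ≤ 1 :=
  norm_cfcₙ_le fun s _ => by
    rw [Real.norm_of_nonneg (cutoff_nonneg n s)]; exact cutoff_le_one n s

theorem cfcₙ_cutoff_zero (h : A) : cfcₙ (cutoff 0) h = 0 :=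
  cfcₙ_const_zero ℝ h

theorem cfcₙ_cutoff_mul_cutoff {n m : ℕ} (hnm : n < m) (h : A) :
    cfcₙ (cutoff n) h * cfcₙ (cutoff m) h = cfcₙ (cutoff n) h := by
  rw [← cfcₙ_mul ..]
  simp_rw [cutoff_mul_cutoff hnm]

theorem cfcₙ_cutoff_mul_cutoffSqrt {n k : ℕ} (hnk : n < k) (h : A) :
    cfcₙ (cutoff n) h * cfcₙ (cutoffSqrt k) h = 0 := by
  rw [← cfcₙ_mul ..]
  simp_rw [cutoff_mul_cutoffSqrt hnk]
  exact cfcₙ_const_zero ℝ h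

theorem sum_cfcₙ_cutoffSqrt_mul_self (n : ℕ) (h : A) :
    ∑ k ∈ Finset.range n, cfcₙ (cutoffSqrt k) h * cfcₙ (cutoffSqrt k) h = cfcₙ (cutoff n) h := by
  rw [← sub_zero (cfcₙ (cutoff n) h), ← cfcₙ_cutoff_zero h,
    ← Finset.sum_range_sub (fun k => cfcₙ (cutoff k) h) n]
  refine Finset.sum_congr rfl fun k _ => ?_
  rw [← cfcₙ_mul .., ← cfcₙ_sub ..]
  simp_rw [← sq, cutoffSqrt_sq]

attribute [local instance] CStarAlgebra.spectralOrder CStarAlgebra.spectralOrderedRing in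
theorem norm_sub_mul_cfcₙ_cutoff_le (a : A) (n : ℕ) (h : A) :
    ‖a - a * cfcₙ (cutoff n) h‖ ≤ ‖a‖ := by
  set e := cfcₙ (cutoff n) h
  have he : star e = e := (cfcₙ_predicate (R := ℝ) (cutoff n) h : IsSelfAdjoint e)
  have hpos : 0 ≤ e + e - e * e := by
    rw [← cfcₙ_add .., ← cfcₙ_mul .., ← cfcₙ_sub ..]
    refine cfcₙ_nonneg fun s _ => ?_
    nlinarith [cutoff_nonneg n s, cutoff_le_one n s]
  refine le_of_sq_le_sq ?_ (norm_nonneg a)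
  rw [sq, sq, ← CStarRing.norm_self_mul_star, ← CStarRing.norm_self_mul_star]
  refine CStarAlgebra.norm_le_norm_of_nonneg_of_le (mul_star_self_nonneg _) (sub_nonneg.1 ?_)
  convert star_right_conjugate_nonneg hpos a using 1
  simp only [star_sub, star_mul, he, mul_sub, sub_mul, mul_add, add_mul, mul_assoc]
  abel

theorem antitone_norm_sub_mul_cfcₙ_cutoff (a h : A) :
    Antitone fun n => ‖a - a * cfcₙ (cutoff n) h‖ := by
  refine antitone_nat_of_succ_le fun n => ?_
  have hnested : a - a * cfcₙ (cutoff (n + 1)) h = (a - a * cfcₙ (cutoff n) h) -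
      (a - a * cfcₙ (cutoff n) h) * cfcₙ (cutoff (n + 1)) h := by
    rw [sub_mul, mul_assoc, cfcₙ_cutoff_mul_cutoff n.lt_succ_self]
    abel
  rw [hnested]
  exact norm_sub_mul_cfcₙ_cutoff_le _ _ h

theorem tendsto_self_mul_cfcₙ_cutoff (hh : IsSelfAdjoint h) :
    Tendsto (fun n => h * cfcₙ (cutoff n) h) atTop (𝓝 h) := by
  refine (tendsto_add_atTop_iff_nat 1).1 (tendsto_iff_norm_sub_tendsto_zero.2 ?_)
  refine squeeze_zero (g := fun n : ℕ => 2 * (1 / 2 : ℝ) ^ n) (fun _ => norm_nonneg _)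
    (fun n => ?_) ?_
  · rw [norm_sub_rev]
    have : h - h * cfcₙ (cutoff (n + 1)) h = cfcₙ (fun s : ℝ => s - s * cutoff (n + 1) s) h := by
      rw [cfcₙ_sub .., cfcₙ_mul .., cfcₙ_id' ℝ h]
    rw [this]
    exact norm_cfcₙ_le fun s _ => abs_sub_mul_cutoff_succ_le n s
  · simpa using (tendsto_pow_atTop_nhds_zero_of_lt_one (r := (1 / 2 : ℝ)) (by norm_num)
      (by norm_num)).const_mul 2

theorem IsStrictlyPositiveElement.tendsto_mul_cfcₙ_cutoff (hh : IsStrictlyPositiveElement h)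
    (a : A) : Tendsto (fun n => a * cfcₙ (cutoff n) h) atTop (𝓝 a) :=
  hh.tendsto_mul (fun _ => cfcₙ_predicate _ h) (fun n => norm_cfcₙ_cutoff_le_one n h)
    (tendsto_self_mul_cfcₙ_cutoff hh.isSelfAdjoint) a

end Cutoff

section SigmaCompactPieces

open scoped ZeroAtInfty

theorem countable_setOf_reflTransGen {α : Type*} {R : α → α → Prop}
    (hR : ∀ i, {j | R i j}.Countable) (i : α) : {j | Relation.ReflTransGen R i j}.Countable := by
  let next (S : Set α) : Set α := ⋃ k ∈ S, {j | R k j}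
  have hcount (n : ℕ) : (next^[n] {i}).Countable := by
    induction n with
    | zero => exact countable_singleton i
    | succ n ih =>
      rw [Function.iterate_succ_apply']
      exact ih.biUnion fun k _ => hR k
  refine (countable_iUnion hcount).mono fun j hij => ?_
  induction hij with
  | refl => exact mem_iUnion.2 ⟨0, rfl⟩
  | tail _ hjk ih =>
    obtain ⟨n, hn⟩ := mem_iUnion.1 ih
    refine mem_iUnion.2 ⟨n + 1, ?_⟩
    rw [Function.iterate_succ_apply']
    exact mem_biUnion hn hjk

variable {Ω : Type u} [TopologicalSpace Ω]

theorem exists_zeroAtInfty_pos_iff {ι : Type*} [Countable ι] {ψ : ι → C₀(Ω, ℝ)}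
    (hψ : ∀ i t, 0 ≤ ψ i t) :
    ∃ η : C₀(Ω, ℝ), (∀ t, 0 ≤ η t) ∧ ∀ t, 0 < η t ↔ ∃ i, 0 < ψ i t := by
  have := Encodable.ofCountable ι
  obtain ⟨ε, hε, _, hsum, -⟩ := posSumOfEncodable one_pos ι
  let w (i : ι) : ℝ := ε i / (1 + ‖ψ i‖)
  have hw (i : ι) : 0 < w i := div_pos (hε i) (by positivity)
  have hbound (i : ι) (t : Ω) : ‖w i * ψ i t‖ ≤ ε i := by
    have hψt : ‖ψ i t‖ ≤ 1 + ‖ψ i‖ := ((ψ i).toBCF.norm_coe_le_norm t).trans (by simp)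
    calc ‖w i * ψ i t‖ = w i * ‖ψ i t‖ := by rw [norm_mul, Real.norm_of_nonneg (hw i).le]
      _ ≤ w i * (1 + ‖ψ i‖) := by gcongr; exact (hw i).le
      _ = ε i := div_mul_cancel₀ _ (by positivity)
  have hsummable (t : Ω) : Summable fun i => w i * ψ i t :=
    hsum.summable.of_norm_bounded fun i => hbound i t
  have hnonneg (i : ι) (t : Ω) : 0 ≤ w i * ψ i t := mul_nonneg (hw i).le (hψ i t)
  refine ⟨⟨⟨fun t => ∑' i, w i * ψ i t, ?_⟩, ?_⟩, fun t => tsum_nonneg fun i => hnonneg i t,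
    fun t => ⟨fun hpos => ?_, fun ⟨i, hi⟩ => ?_⟩⟩
  · exact continuous_tsum (fun i => by fun_prop) hsum.summable fun i t => hbound i t
  · have hlim (i : ι) : Tendsto (fun t => w i * ψ i t) (cocompact Ω) (𝓝 0) := by
      simpa using (zero_at_infty (ψ i)).const_mul (w i)
    simpa using tendsto_tsum_of_dominated_convergence hsum.summable hlim
      (Eventually.of_forall fun t i => hbound i t)
  · by_contra! hle
    have hzero (i : ι) : ψ i t = 0 := le_antisymm (hle i) (hψ i t)
    simp [hzero] at hpos
  · exact (hsummable t).tsum_pos (fun i => hnonneg i t) i (mul_pos (hw i) hi)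

variable (Ω) [T2Space Ω] [LocallyCompactSpace Ω] [ParacompactSpace Ω]

theorem exists_partitionOfUnity_hasCompactSupport :
    ∃ ψ : PartitionOfUnity Ω Ω univ, ∀ i, HasCompactSupport (ψ i) := by
  choose N hN hNt using fun t : Ω => exists_compact_mem_nhds t
  obtain ⟨ψ, hψ⟩ := PartitionOfUnity.exists_isSubordinate (isClosed_univ (X := Ω))
    (fun t => interior (N t)) (fun _ => isOpen_interior)
    fun t _ => mem_iUnion.2 ⟨t, mem_interior_iff_mem_nhds.2 (hNt t)⟩
  exact ⟨ψ, fun i =>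
    (hN i).of_isClosed_subset (isClosed_tsupport _) ((hψ i).trans interior_subset)⟩

-- The `σ`-compact open pieces `{t | 0 < η i t}` of `Ω` come from the classes of the functions of a
-- partition of unity that are linked by overlaps: each function overlaps finitely many others.
theorem exists_zeroAtInfty_existsUnique_pos :
    ∃ (ι : Type u) (η : ι → C₀(Ω, ℝ)), (∀ i t, 0 ≤ η i t) ∧
      ∀ t, ∃ i, 0 < η i t ∧ ∀ j ≠ i, η j t = 0 := by
  obtain ⟨ψ, hψ⟩ := exists_partitionOfUnity_hasCompactSupport Ω
  let Overlap (i j : Ω) : Prop := ∃ t, 0 < ψ i t ∧ 0 < ψ j t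
  have hcount (i : Ω) : {j | Overlap i j}.Countable := by
    refine ((ψ.locallyFinite.finite_nonempty_inter_compact (hψ i)).subset ?_).countable
    rintro j ⟨t, hi, hj⟩
    exact ⟨t, hj.ne', subset_tsupport _ hi.ne'⟩
  have : Std.Symm Overlap := ⟨fun _ _ ⟨t, hi, hj⟩ => ⟨t, hj, hi⟩⟩
  let linked : Setoid Ω :=
    ⟨Relation.ReflTransGen Overlap, fun _ => .refl, Std.Symm.symm _ _, .trans⟩
  let member (q : Quotient linked) (i : {i // ⟦i⟧ = q}) : C₀(Ω, ℝ) :=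
    ⟨ψ i, (hψ i).is_zero_at_infty⟩
  have hclass (q : Quotient linked) : Countable {i // ⟦i⟧ = q} := by
    induction q using Quotient.inductionOn with | h o => ?_
    exact ((countable_setOf_reflTransGen hcount o).mono fun i hi =>
      linked.symm (Quotient.exact hi)).to_subtype
  choose η hη hη_pos using fun q : Quotient linked =>
    exists_zeroAtInfty_pos_iff (ψ := member q) fun i t => ψ.nonneg i t
  refine ⟨Quotient linked, η, hη, fun t => ?_⟩
  obtain ⟨i, hi⟩ := ψ.exists_pos (mem_univ t)
  refine ⟨⟦i⟧, (hη_pos _ t).2 ⟨⟨i, rfl⟩, hi⟩, fun q hq => ?_⟩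
  by_contra hne
  obtain ⟨⟨k, rfl⟩, hk⟩ := (hη_pos q t).1 ((hη q t).lt_of_ne' hne)
  exact hq (Quotient.sound (.single ⟨t, hk, hi⟩))

end SigmaCompactPieces

namespace ContinuousField

variable {Ω : Type u} [TopologicalSpace Ω] {A : Ω → Type v} [∀ t, NonUnitalCStarAlgebra (A t)]

section VectorFields

theorem ContAt.fun_smul (U : ContinuousField A) (Y : Set Ω) {x : ∀ t : Y, A t} {t : Y}
    (hx : U.ContAt Y x t) {c : Y → ℂ} (hc : ContinuousAt c t) :
    U.ContAt Y (fun s => c s • x s) t := by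
  intro ε hε
  obtain ⟨x', hx', hxx'⟩ := hx (ε / 2 / (‖c t‖ + 1)) (by positivity)
  have hc_bound := hc.norm.eventually_lt_const (lt_add_one ‖c t‖)
  have hc_close := Metric.tendsto_nhds.1 hc (ε / 2 / (‖x' t‖ + 1)) (by positivity)
  refine ⟨c t • x', SMulMemClass.smul_mem _ hx', ?_⟩
  filter_upwards [hxx', U.eventually_norm_le Y hx' t, hc_bound, hc_close] with s hxs hx's hcs hcst
  rw [dist_eq_norm] at hcst
  calc ‖c s • x s - c t • x' s‖ = ‖c s • (x s - x' s) + (c s - c t) • x' s‖ := by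
        congr 1; module
    _ ≤ ‖c s‖ * ‖x s - x' s‖ + ‖c s - c t‖ * ‖x' s‖ := by
        simpa only [norm_smul] using norm_add_le (c s • (x s - x' s)) ((c s - c t) • x' s)
    _ ≤ (‖c t‖ + 1) * (ε / 2 / (‖c t‖ + 1)) + ε / 2 / (‖x' t‖ + 1) * (‖x' t‖ + 1) := by
        gcongr
    _ = ε := by field_simp; ring

theorem smul_mem_of_tsupport_subset (U : ContinuousField A) {V : Set Ω} (hV : IsOpen V)
    {x : ∀ t, A t} (hx : (fun s : V => x s) ∈ (U.restrict V).Θ) {c : Ω → ℂ} (hc : Continuous c)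
    (hcV : tsupport c ⊆ V) : (fun t => c t • x t) ∈ U.Θ := by
  refine U.mem_of_locally_approx _ fun t ε hε => ?_
  by_cases ht : t ∈ tsupport c
  · have hcx := (hx ⟨t, hcV ht⟩).fun_smul U V (c := fun s => c s) (by fun_prop)
    simpa only [← hV.isOpenEmbedding_subtypeVal.map_nhds_eq ⟨t, hcV ht⟩, eventually_map]
      using hcx ε hε
  · refine ⟨0, zero_mem _, ?_⟩
    filter_upwards [(isClosed_tsupport c).isOpen_compl.mem_nhds ht] with s hs
    simp [image_eq_zero_of_notMem_tsupport hs, hε.le]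

theorem smul_mem (U : ContinuousField A) {x : ∀ t, A t} (hx : x ∈ U.Θ) {c : Ω → ℂ}
    (hc : Continuous c) : (fun t => c t • x t) ∈ U.Θ :=
  U.smul_mem_of_tsupport_subset isOpen_univ (fun t => ContAt.of_mem U univ hx t) hc
    (subset_univ _)

theorem finsum_mem (U : ContinuousField A) {ι : Type*} {x : ι → ∀ t, A t} (hx : ∀ i, x i ∈ U.Θ)
    (hfinite : LocallyFinite fun i => {t | x i t ≠ 0}) : (fun t => ∑ᶠ i, x i t) ∈ U.Θ := by
  refine U.mem_of_locally_approx _ fun t ε hε => ?_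
  obtain ⟨W, hW, hWfinite⟩ := hfinite t
  refine ⟨∑ i ∈ hWfinite.toFinset, x i, sum_mem fun i _ => hx i, ?_⟩
  filter_upwards [hW] with s hs
  rw [Finset.sum_apply, finsum_eq_sum_of_support_subset _ fun i hi => ?_, sub_self, norm_zero]
  · exact hε.le
  · simpa using ⟨s, hi, hs⟩

theorem exists_strictlyPositive_of_isTrivial (U : ContinuousField A) {V : Set Ω}
    (hV : (U.restrict V).IsTrivial) {p : Ω} (hp : p ∈ V) {h : A p}
    (hh : IsStrictlyPositiveElement h) :
    ∃ x : ∀ t, A t, (fun s : V => x s) ∈ (U.restrict V).Θ ∧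
      ∀ t ∈ V, IsStrictlyPositiveElement (x t) := by
  classical
  obtain ⟨B, _, ⟨Φ⟩⟩ := hV
  set b := Φ.φ ⟨p, hp⟩ h
  refine ⟨fun t => if ht : t ∈ V then (Φ.φ ⟨t, ht⟩).symm b else 0, ?_, fun t ht => ?_⟩
  · have hconst : (fun t : V => Φ.φ t (if ht : (t : Ω) ∈ V then (Φ.φ ⟨t, ht⟩).symm b else 0)) =
        fun _ => b := by
      funext t
      simp [t.2]
    rw [Φ.mem_iff, hconst]
    exact continuous_const (X := V)
  · simp only [ht, dite_true]
    exact (hh.map (Φ.φ ⟨p, hp⟩)).map (Φ.φ ⟨t, ht⟩).symm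

theorem exists_strictlyPositive [T2Space Ω] [ParacompactSpace Ω] (U : ContinuousField A)
    (hU : U.IsLocallyTrivial) (hA : ∀ t, ∃ h : A t, IsStrictlyPositiveElement h) :
    ∃ x ∈ U.Θ, ∀ t, IsStrictlyPositiveElement (x t) := by
  choose h hh using hA
  choose V hVo hVt hV using hU
  choose x hx hxV using fun p => U.exists_strictlyPositive_of_isTrivial (hV p) (hVt p) (hh p)
  obtain ⟨ψ, hψ⟩ := PartitionOfUnity.exists_isSubordinate (isClosed_univ (X := Ω)) V hVo
    fun t _ => mem_iUnion.2 ⟨t, hVt t⟩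
  refine ⟨fun t => ∑ᶠ p, (ψ p t : ℂ) • x p t, U.finsum_mem (fun p => ?_) ?_, fun t => ?_⟩
  · refine U.smul_mem_of_tsupport_subset (hVo p) (hx p) (c := fun t => (ψ p t : ℂ)) (by fun_prop)
      ((closure_mono fun t ht => ?_).trans (hψ p))
    exact Complex.ofReal_ne_zero.1 ht
  · exact ψ.locallyFinite.subset fun p t ht => Complex.ofReal_ne_zero.1 (left_ne_zero_of_smul ht)
  · have hfinite : (Function.support fun p => ψ p t).Finite := ψ.locallyFinite.point_finite t
    obtain ⟨p₀, hp₀⟩ := ψ.exists_pos (mem_univ t)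
    have hsum : ∑ᶠ p, (ψ p t : ℂ) • x p t = ∑ p ∈ hfinite.toFinset, ψ p t • x p t :=
      finsum_eq_sum_of_support_subset _ fun p hp =>
        hfinite.mem_toFinset.2 (Complex.ofReal_ne_zero.1 (left_ne_zero_of_smul hp))
    change IsStrictlyPositiveElement (∑ᶠ p, (ψ p t : ℂ) • x p t)
    rw [hsum]
    refine IsStrictlyPositiveElement.sum ⟨p₀, hfinite.mem_toFinset.2 hp₀.ne'⟩ fun p hp => ?_
    have hp : ψ p t ≠ 0 := hfinite.mem_toFinset.1 hp
    exact (hxV p t (hψ p (subset_tsupport _ hp))).smul ((ψ.nonneg p t).lt_of_ne' hp)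

end VectorFields

section Evaluation

-- Stated for `U.sectionAlgebra` because the ring structure that it inherits from `lp A ∞` agrees
-- with the one behind its `NonUnitalCStarAlgebra` structure only after unfolding definitions.
instance (U : ContinuousField A) :
    NonUnitalContinuousFunctionalCalculus ℝ U.sectionAlgebra IsSelfAdjoint :=
  have (B : Type (max u v)) [NonUnitalCStarAlgebra B] :
    NonUnitalContinuousFunctionalCalculus ℝ B IsSelfAdjoint := inferInstance
  this U.sectionAlgebra

/-- The evaluation of the sections at a point, as a `*`-homomorphism. -/
def eval (U : ContinuousField A) (t : Ω) : U.sectionAlgebra →⋆ₙₐ[ℂ] A t where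
  toFun a := (a : lp A ∞) t
  map_smul' _ _ := rfl
  map_zero' := rfl
  map_add' _ _ := rfl
  map_mul' _ _ := rfl
  map_star' _ := rfl

variable (U : ContinuousField A)

theorem ext_eval {a b : U.sectionAlgebra} (h : ∀ t, U.eval t a = U.eval t b) : a = b :=
  Subtype.ext (lp.ext (funext h))

theorem norm_le_of_eval {a : U.sectionAlgebra} {C : ℝ} (hC : 0 ≤ C)
    (h : ∀ t, ‖U.eval t a‖ ≤ C) : ‖a‖ ≤ C :=
  lp.norm_le_of_forall_le hC h

theorem continuous_norm_eval (a : U.sectionAlgebra) : Continuous fun t => ‖U.eval t a‖ :=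
  U.continuous_norm _ a.2.1

theorem tendsto_norm_eval_cocompact (a : U.sectionAlgebra) :
    Tendsto (fun t => ‖U.eval t a‖) (cocompact Ω) (𝓝 0) :=
  a.2.2

theorem eval_cfcₙ {a : U.sectionAlgebra} (ha : IsSelfAdjoint a) {g : ℝ → ℝ} (hg : Continuous g)
    (hg0 : g 0 = 0) (t : Ω) : U.eval t (cfcₙ g a) = cfcₙ g (U.eval t a) :=
  NonUnitalStarAlgHom.map_cfcₙ (U.eval t) g a hg.continuousOn hg0
    (AddMonoidHomClass.continuous_of_bound (U.eval t) 1 fun x => by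
      simpa using NonUnitalStarAlgHom.norm_apply_le (U.eval t) x) ha (ha.map (U.eval t))

theorem signedSumsBounded_of_eval {κ : Type*} {x : κ → U.sectionAlgebra} {C : ℝ} (hC : 0 ≤ C)
    (hx : ∀ t, SignedSumsBounded (fun k => U.eval t (x k)) C) : SignedSumsBounded x C := by
  intro F ε
  refine U.norm_le_of_eval hC fun t => ?_
  simpa only [Units.smul_def, map_sum, map_zsmul] using hx t F ε

-- Dini's theorem on a compact set outside of which all but finitely many norms are small.
theorem tendsto_zero_of_antitone_norm_eval {N : Type*} [Preorder N] [Nonempty N]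
    {b : N → U.sectionAlgebra} (hanti : ∀ t, Antitone fun n => ‖U.eval t (b n)‖)
    (hlim : ∀ t, Tendsto (fun n => ‖U.eval t (b n)‖) atTop (𝓝 0)) :
    Tendsto b atTop (𝓝 0) := by
  rw [Metric.tendsto_nhds]
  intro ε hε
  obtain ⟨n₀⟩ := ‹Nonempty N›
  obtain ⟨K, hK, hKε⟩ := mem_cocompact.1
    ((U.tendsto_norm_eval_cocompact (b n₀)).eventually_lt_const (half_pos hε))
  have dini := Antitone.tendstoUniformlyOn_of_forall_tendsto hK
    (fun n => (U.continuous_norm_eval (b n)).continuousOn) (fun t _ => hanti t)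
    (continuousOn_const (c := (0 : ℝ))) fun t _ => hlim t
  filter_upwards [Metric.tendstoUniformlyOn_iff.1 dini _ (half_pos hε), eventually_ge_atTop n₀]
    with n hn hle
  rw [dist_zero_right]
  refine (U.norm_le_of_eval (half_pos hε).le fun t => ?_).trans_lt (half_lt_self hε)
  by_cases ht : t ∈ K
  · simpa using (hn t ht).le
  · exact (hanti t hle).trans (le_of_lt (hKε ht))

end Evaluation

section FibrewiseStrictlyPositive

variable {U : ContinuousField A} {ι : Type*} {h : ι → U.sectionAlgebra}

/-- At every point one of the sections `h i` is strictly positive and all the others vanish: a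
substitute for a strictly positive element of the algebra of sections, which need not exist if the
base is not `σ`-compact. -/
def IsFibrewiseStrictlyPositive (U : ContinuousField A) (h : ι → U.sectionAlgebra) : Prop :=
  ∀ t, ∃ i, IsStrictlyPositiveElement (U.eval t (h i)) ∧ ∀ j ≠ i, U.eval t (h j) = 0

theorem exists_isFibrewiseStrictlyPositive [T2Space Ω] [LocallyCompactSpace Ω]
    [ParacompactSpace Ω] (U : ContinuousField A) {x : ∀ t, A t} (hx : x ∈ U.Θ)
    (hpos : ∀ t, IsStrictlyPositiveElement (x t)) :
    ∃ (ι : Type u) (h : ι → U.sectionAlgebra), U.IsFibrewiseStrictlyPositive h := by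
  obtain ⟨ι, η, hη, hη_unique⟩ := exists_zeroAtInfty_existsUnique_pos Ω
  let c (i : ι) (t : Ω) : ℝ := η i t / (1 + ‖x t‖)
  have hc (i : ι) : Continuous (c i) :=
    (η i).continuous.div (continuous_const.add (U.continuous_norm x hx)) fun t => by positivity
  have hnorm (i : ι) (t : Ω) : ‖(c i t : ℂ) • x t‖ ≤ η i t := by
    rw [norm_smul, Complex.norm_real, Real.norm_of_nonneg (div_nonneg (hη i t) (by positivity)),
      div_mul_eq_mul_div, div_le_iff₀ (by positivity)]
    exact mul_le_mul_of_nonneg_left (by linarith) (hη i t)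
  have hsection (i : ι) : ∃ a : U.sectionAlgebra, ∀ t, U.eval t a = (c i t : ℂ) • x t :=
    U.exists_mem_sectionAlgebra _ (U.smul_mem hx (Complex.continuous_ofReal.comp (hc i)))
      (squeeze_zero (fun t => norm_nonneg _) (hnorm i) (zero_at_infty (η i)))
  choose h hh using hsection
  refine ⟨ι, h, fun t => ?_⟩
  obtain ⟨i, hi, hne⟩ := hη_unique t
  refine ⟨i, ?_, fun j hj => by simp [hh, c, hne j hj]⟩
  rw [hh, Complex.coe_smul]
  exact (hpos t).smul (div_pos hi (by positivity))

/-- The approximate unit `∑ i ∈ F, cutoff n (h i)`, indexed by the pairs `(F, n)`. -/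
def approxUnit (h : ι → U.sectionAlgebra) (N : Finset ι × ℕ) : U.sectionAlgebra :=
  ∑ i ∈ N.1, cfcₙ (cutoff N.2) (h i)

namespace IsFibrewiseStrictlyPositive

theorem isSelfAdjoint (hh : U.IsFibrewiseStrictlyPositive h) (i : ι) : IsSelfAdjoint (h i) :=
  U.ext_eval fun t => by
    obtain ⟨i₀, hi₀, hne⟩ := hh t
    rw [map_star]
    rcases eq_or_ne i i₀ with rfl | hi
    · exact hi₀.isSelfAdjoint.star_eq
    · rw [hne i hi, star_zero]

theorem eval_cfcₙ_eq_zero (hh : U.IsFibrewiseStrictlyPositive h) {g : ℝ → ℝ} (hg : Continuous g)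
    (hg0 : g 0 = 0) {i : ι} {t : Ω} (hi : U.eval t (h i) = 0) :
    U.eval t (cfcₙ g (h i)) = 0 := by
  rw [U.eval_cfcₙ (hh.isSelfAdjoint i) hg hg0, hi, cfcₙ_apply_zero]

theorem cfcₙ_mul_cfcₙ_eq_zero (hh : U.IsFibrewiseStrictlyPositive h) {f g : ℝ → ℝ}
    (hf : Continuous f) (hf0 : f 0 = 0) (hg : Continuous g) (hg0 : g 0 = 0) {i j : ι}
    (hij : i ≠ j) : cfcₙ f (h i) * cfcₙ g (h j) = 0 :=
  U.ext_eval fun t => by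
    obtain ⟨i₀, -, hne⟩ := hh t
    rw [map_mul, map_zero]
    rcases eq_or_ne i i₀ with rfl | hi
    · rw [hh.eval_cfcₙ_eq_zero hg hg0 (hne j hij.symm), mul_zero]
    · rw [hh.eval_cfcₙ_eq_zero hf hf0 (hne i hi), zero_mul]

theorem exists_eval_approxUnit_eq_cfcₙ_cutoff (hh : U.IsFibrewiseStrictlyPositive h) (t : Ω) :
    ∃ (k : A t) (level : Finset ι × ℕ → ℕ), IsStrictlyPositiveElement k ∧ Monotone level ∧
      Tendsto level atTop atTop ∧
      ∀ N, U.eval t (approxUnit h N) = cfcₙ (cutoff (level N)) k := by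
  classical
  obtain ⟨i, hi, hne⟩ := hh t
  have hmono : Monotone fun N : Finset ι × ℕ => if i ∈ N.1 then N.2 else 0 := by
    intro N M hNM
    by_cases hN : i ∈ N.1
    · simpa [hN, hNM.1 hN] using hNM.2
    · simp [hN]
  refine ⟨U.eval t (h i), _, hi, hmono,
    tendsto_atTop_atTop_of_monotone hmono fun n => ⟨({i}, n), by simp⟩, fun N => ?_⟩
  have hother (j : ι) (hj : j ≠ i) : U.eval t (cfcₙ (cutoff N.2) (h j)) = 0 :=
    hh.eval_cfcₙ_eq_zero (by fun_prop) (by simp) (hne j hj)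
  rw [approxUnit, map_sum]
  by_cases hN : i ∈ N.1
  · rw [Finset.sum_eq_single_of_mem i hN fun j _ => hother j, if_pos hN,
      U.eval_cfcₙ (hh.isSelfAdjoint i) (by fun_prop) (by simp)]
  · rw [if_neg hN, cfcₙ_cutoff_zero]
    exact Finset.sum_eq_zero fun j hj => hother j (ne_of_mem_of_not_mem hj hN)

theorem tendsto_mul_approxUnit (hh : U.IsFibrewiseStrictlyPositive h) (a : U.sectionAlgebra) :
    Tendsto (fun N => a * approxUnit h N) atTop (𝓝 a) := by
  suffices hlim : Tendsto (fun N => a - a * approxUnit h N) atTop (𝓝 0) by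
    simpa using hlim.const_sub a
  refine U.tendsto_zero_of_antitone_norm_eval (fun t => ?_) fun t => ?_ <;>
    obtain ⟨k, level, hk, hmono, hlevel, heval⟩ := hh.exists_eval_approxUnit_eq_cfcₙ_cutoff t <;>
    simp only [map_sub, map_mul, heval]
  · exact (antitone_norm_sub_mul_cfcₙ_cutoff (U.eval t a) k).comp_monotone hmono
  · have hlim := (hk.tendsto_mul_cfcₙ_cutoff (U.eval t a)).comp hlevel
    simpa using (hlim.const_sub (U.eval t a)).norm

theorem approxUnit_mul_approxUnit (hh : U.IsFibrewiseStrictlyPositive h) (F : Finset ι) {n m : ℕ}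
    (hnm : n < m) : approxUnit h (F, n) * approxUnit h (F, m) = approxUnit h (F, n) := by
  simp only [approxUnit, Finset.sum_mul]
  refine Finset.sum_congr rfl fun i hi => ?_
  rw [Finset.mul_sum, Finset.sum_eq_single_of_mem i hi fun j _ hj =>
      hh.cfcₙ_mul_cfcₙ_eq_zero (by fun_prop) (by simp) (by fun_prop) (by simp) hj.symm]
  exact cfcₙ_cutoff_mul_cutoff hnm (h i)

theorem approxUnit_mul_cfcₙ_cutoffSqrt (hh : U.IsFibrewiseStrictlyPositive h) {F : Finset ι}
    {n k : ℕ} {i : ι} (hik : i ∈ F → n < k) :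
    approxUnit h (F, n) * cfcₙ (cutoffSqrt k) (h i) = 0 := by
  simp only [approxUnit, Finset.sum_mul]
  refine Finset.sum_eq_zero fun j hj => ?_
  rcases eq_or_ne j i with rfl | hji
  · exact cfcₙ_cutoff_mul_cutoffSqrt (hik hj) (h j)
  · exact hh.cfcₙ_mul_cfcₙ_eq_zero (by fun_prop) (by simp) (by fun_prop) (by simp) hji

theorem signedSumsBounded (hh : U.IsFibrewiseStrictlyPositive h) :
    SignedSumsBounded (fun p : ι × ℕ => cfcₙ (cutoffSqrt p.2) (h p.1)) √2 := by
  refine U.signedSumsBounded_of_eval (Real.sqrt_nonneg 2) fun t => ?_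
  obtain ⟨i, -, hne⟩ := hh t
  refine SignedSumsBounded.of_comp_injective (Prod.mk_right_injective i) ?_ fun p hp => ?_
  · convert signedSumsBounded_cfcₙ_cutoffSqrt (U.eval t (h i)) using 2 with k
    exact U.eval_cfcₙ (hh.isSelfAdjoint i) (by fun_prop) (by simp) t
  · exact hh.eval_cfcₙ_eq_zero (by fun_prop) (by simp) (hne _ fun hpi => hp ⟨p.2, by rw [← hpi]⟩)

theorem isDiagonalFamily (hh : U.IsFibrewiseStrictlyPositive h) :
    IsDiagonalFamily (fun p : ι × ℕ => cfcₙ (cutoffSqrt p.2) (h p.1)) √2 where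
  signedSumsBounded := hh.signedSumsBounded
  dense a := by
    classical
    refine mem_closure_of_tendsto (hh.tendsto_mul_approxUnit a) (Eventually.of_forall ?_)
    rintro ⟨F, n⟩
    refine ⟨F ×ˢ Finset.range (n + 1), fun p hp => ?_, ?_⟩
    · rw [mul_assoc, hh.approxUnit_mul_cfcₙ_cutoffSqrt fun hpF => ?_, mul_zero]
      by_contra hpn
      exact hp (Finset.mem_product.2 ⟨hpF, Finset.mem_range.2 (by omega)⟩)
    · calc ∑ p ∈ F ×ˢ Finset.range (n + 1), a * approxUnit h (F, n) *
              cfcₙ (cutoffSqrt p.2) (h p.1) * cfcₙ (cutoffSqrt p.2) (h p.1)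
          = a * (approxUnit h (F, n) * approxUnit h (F, n + 1)) := by
            simp only [mul_assoc, ← Finset.mul_sum, Finset.sum_product]
            congr! 2
            refine Finset.sum_congr rfl fun i _ => ?_
            exact sum_cfcₙ_cutoffSqrt_mul_self (n + 1) (h i)
        _ = a * approxUnit h (F, n) := by rw [hh.approxUnit_mul_approxUnit F n.lt_succ_self]

end IsFibrewiseStrictlyPositive

end FibrewiseStrictlyPositive

end ContinuousField

end

theorem theorem6p15_general {Ω : Type u} [TopologicalSpace Ω] [T2Space Ω] [LocallyCompactSpace Ω]
    [ParacompactSpace Ω] {A : Ω → Type v} [∀ t, NonUnitalCStarAlgebra (A t)]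
    (U : ContinuousField A) {x : ∀ t, A t} (hx : x ∈ U.Θ)
    (hpos : ∀ t, IsStrictlyPositiveElement (x t)) :
    IsLeftProjective.{max u v, w} U.sectionAlgebra ∧
      ∃ ρ : U.sectionAlgebra →L[ℂ] ProjTensorSquare U.sectionAlgebra,
        (∀ a b : U.sectionAlgebra, ρ (a * b) = ProjTensorSquare.leftMul a (ρ b)) ∧
        (∀ a : U.sectionAlgebra, ProjTensorSquare.mulMap (ρ a) = a) ∧ ‖ρ‖ ≤ 2 := by
  obtain ⟨ι, h, hh⟩ := U.exists_isFibrewiseStrictlyPositive hx hpos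
  have hdiagonal := hh.isDiagonalFamily
  exact ⟨hdiagonal.isLeftProjective, hdiagonal.exists_splitting.imp fun ρ hρ =>
    ⟨hρ.1, hρ.2.1, hρ.2.2.trans_eq (Real.sq_sqrt zero_le_two)⟩⟩

theorem theorem6p15 {Ω : Type u} [TopologicalSpace Ω] [T2Space Ω] [LocallyCompactSpace Ω]
    [ParacompactSpace Ω] {A : Ω → Type v} [∀ t, NonUnitalCStarAlgebra (A t)]
    (U : ContinuousField A) (hU : U.IsLocallyTrivial)
    (hA : ∀ t, ∃ h : A t, IsStrictlyPositiveElement h) (ℓ : ℕ) (hℓ : 1 ≤ ℓ)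
    (hdim : CoveringDimLE Ω ℓ ∨ U.IsNLocallyTrivial ℓ) :
    IsLeftProjective.{max u v, w} U.sectionAlgebra ∧
      ∃ ρ : U.sectionAlgebra →L[ℂ] ProjTensorSquare U.sectionAlgebra,
        (∀ a b : U.sectionAlgebra, ρ (a * b) = ProjTensorSquare.leftMul a (ρ b)) ∧
        (∀ a : U.sectionAlgebra, ProjTensorSquare.mulMap (ρ a) = a) ∧
        ‖ρ‖ ≤ (4 * (ℓ : ℝ)) ^ 2 := by
  obtain ⟨x, hx, hpos⟩ := U.exists_strictlyPositive hU hA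
  have hℓ_cast : (1 : ℝ) ≤ ℓ := by exact_mod_cast hℓ
  exact (theorem6p15_general U hx hpos).imp_right <| Exists.imp fun ρ hρ =>
    ⟨hρ.1, hρ.2.1, hρ.2.2.trans (by nlinarith)⟩
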